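/- Let $n\ge 0$. For $w\in S_n$ let $l(w)$ be its number of inversions, let $t_{ij}\in S_n$ be the transposition of $i$ and $j$, and write $(uv)(a)=u(v(a))$. Let $\widetilde{\mathcal E}_{n,0}$ be the associative algebra over $\mathbb Z[y]=\mathbb Z[y_1,\dots,y_n]$ (with the $y_i$ central) generated by symbols $[i,j]$ ($1\le i\ne j\le n$) and $x_1,\dots,x_n$ subject to the relations $[i,j]=-[j,i]$; $[i,j]^2=0$; $[i,j][k,l]=[k,l][i,j]$ if $\{i,j\}\cap\{k,l\}=\emptyset$; $[i,j][j,k]+[j,k][k,i]+[k,i][i,j]=0$ for distinct $i,j,k$; $x_ix_j=x_jx_i$; $[i,j]x_k=x_k[i,j]$ for $k\ne i,j$; $[i,j]x_i=x_j[i,j]+t$ and $[i,j]x_j=x_i[i,j]-t$ for $i<j$, with $t=0$; and $e_r(x_1,\dots,x_n)=e_r(y_1,\dots,y_n)$ for $1\le r\le n$, where $e_r$ is the $r$-th elementary symmetric polynomial. Its Dunkl elements $\theta_i=x_i+\sum_{j\ne i}[i,j]$, $1\le i\le n$, commute pairwise. The extended Bruhat representation is given on $f\underline w$, for a polynomial $f$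 in $y$ and $w\in S_n$, by $$[i,j]\,(f\underline w)=t\,(\partial_{w(i)w(j)}f)\,\underline w+\begin{cases} f\,\underline{wt_{ij}} & \text{if } l(wt_{ij})=l(w)+1,\\ 0&\text{otherwise}\end{cases}\quad(i<j),\qquad x_k\,(f\underline w)=y_{w(k)}f\,\underline w,$$ where $\partial_{ab}=(1-t_{ab})/(y_a-y_b)$. At $t=0$ these operators are $\mathbb Z[y]$-linear and define a representation of $\widetilde{\mathcal E}_{n,0}$ on $\mathbb Z[y]\langle S_n\rangle=\bigoplus_{w\in S_n}\mathbb Z[y]\,\underline w$, the specialization of $\mathbb Z[y][t]\langle S_n\rangle$ at $t=0$. For $w\in S_n$ let $\mathfrak S_w(x,y)=\partial^{(x)}_{w^{-1}w_0}\prod_{i+j\le n}(x_i-y_j)$ be the double Schubert polynomial, where $w_0$ is the longest element of $S_n$, and $\partial^{(x)}_u=\partial_{i_1,i_1+1}\cdots\partial_{i_r,i_r+1}$, acting on the $x$-variables, for a reduced decomposition $u=s_{i_1}\cdots s_{i_r}$ into the simple transpositions $s_i=t_{i,i+1}$. Theorem. Under the extended Bruhat representation at $t=0$, for every $w\in S_n$,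 $$\mathfrak S_w(\theta_1,\dots,\theta_n,y)\,(\underline{\mathrm{id}})=\underline w .$$ -/

import Mathlib

/-! ### Length of a permutation

`S_n` is `Equiv.Perm (Fin n)`, with `(u * v) a = u (v a)`; indices run over `0, …, n - 1`, and
`t_{ij}` is `Equiv.swap i j`. -/

section Length

open scoped Finset

/-- The length `l(w)` of a permutation: its number of inversions. -/
def invNum {n : ℕ} (w : Equiv.Perm (Fin n)) : ℕ :=
  #{p : Fin n × Fin n | p.1 < p.2 ∧ w p.2 < w p.1}

theorem invNum_eq_sum {n : ℕ} (w : Equiv.Perm (Fin n)) :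
    (invNum w : ℤ) = ∑ a, ∑ b, if a < b ∧ w b < w a then 1 else 0 := by
  rw [invNum, Finset.card_filter, Nat.cast_sum, Fintype.sum_prod_type]
  simp

theorem invNum_mul_swap_sub {n : ℕ} (w : Equiv.Perm (Fin n)) {i j : Fin n} (hij : i < j) :
    (invNum (w * Equiv.swap i j) : ℤ) - invNum w =
      (if w i < w j then 1 else -1) + 2 * ∑ c, if i < c ∧ c < j then
        ((if w i < w c ∧ w c < w j then 1 else 0) -
          (if w j < w c ∧ w c < w i then 1 else 0) : ℤ) else 0 := by
  set t := Equiv.swap i j with ht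
  let F : Fin n → Fin n → ℤ := fun a b =>
    (if t a < t b ∧ w b < w a then 1 else 0) - (if a < b ∧ w b < w a then 1 else 0)
  let H : Fin n → ℤ := fun c => if i < c ∧ c < j then
        ((if w i < w c ∧ w c < w j then 1 else 0) -
          (if w j < w c ∧ w c < w i then 1 else 0) : ℤ) else 0
  have hne : i ≠ j := hij.ne
  have h1 : (invNum (w * t) : ℤ) = ∑ a, ∑ b, if t a < t b ∧ w b < w a then 1 else 0 := by
    rw [invNum_eq_sum, ← Equiv.sum_comp t]
    refine Finset.sum_congr rfl fun a _ => ?_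
    rw [← Equiv.sum_comp t]
    simp [ht]
  have h2 : (invNum (w * t) : ℤ) - invNum w = ∑ a, ∑ b, F a b := by
    rw [h1, invNum_eq_sum]
    simp only [F, Finset.sum_sub_distrib]
  have hF0 : ∀ a b, a ≠ i → a ≠ j → b ≠ i → b ≠ j → F a b = 0 := by
    intro a b h1 h2 h3 h4
    simp [F, t, Equiv.swap_apply_of_ne_of_ne, *]
  have h3 : ∀ a b, F a b = (if b = i then F a i else 0) + (if b = j then F a j else 0)
      + (if a = i then F i b else 0) + (if a = j then F j b else 0)
      - (if a = i then if b = i then F i i else 0 else 0)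
      - (if a = i then if b = j then F i j else 0 else 0)
      - (if a = j then if b = i then F j i else 0 else 0)
      - (if a = j then if b = j then F j j else 0 else 0) := by
    intro a b
    by_cases hai : a = i
    · subst hai
      by_cases hbi : b = a
      · subst hbi; simp [hne]
      · by_cases hbj : b = j
        · subst hbj; simp [hne, hne.symm]
        · simp [hne, hbi, hbj]
    · by_cases haj : a = j
      · subst haj
        by_cases hbi : b = i
        · subst hbi; simp [hne.symm]
        · by_cases hbj : b = a
          · subst hbj; simp [hne.symm]
          · simp [hne.symm, hbi, hbj]
      · by_cases hbi : b = i
        · subst hbi; simp [hne, hai, haj]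
        · by_cases hbj : b = j
          · subst hbj; simp [hne.symm, hai, haj]
          · simp [hai, haj, hbi, hbj, hF0]
  have hFii : F i i = 0 := by simp [F]
  have hFjj : F j j = 0 := by simp [F]
  have hFs : F i j + F j i = if w i < w j then 1 else -1 := by
    have : w i ≠ w j := fun h => hne (w.injective h)
    rcases lt_or_gt_of_ne this with h | h
    · simp [F, ht, hij, hij.not_gt, h, h.not_gt]
    · simp [F, ht, hij, hij.not_gt, h, h.not_gt]
  have h4 : ∀ c, F c i + F c j + F i c + F j c = 2 * H c + (if c = i then F i j + F j i else 0)
      + (if c = j then F i j + F j i else 0) := by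
    intro c
    by_cases hci : c = i
    · subst hci; simp [H, hne, hFii]
    · by_cases hcj : c = j
      · subst hcj; simp [H, hne.symm, hFjj, add_comm]
      · have hw1 : w c ≠ w i := fun h => hci (w.injective h)
        have hw2 : w c ≠ w j := fun h => hcj (w.injective h)
        have e : t c = c := Equiv.swap_apply_of_ne_of_ne hci hcj
        have e1 : t i = j := Equiv.swap_apply_left _ _
        have e2 : t j = i := Equiv.swap_apply_right _ _
        simp only [F, H, e, e1, e2, hci, hcj, if_false]
        clear_value F H t
        clear h1 h2 h3 hF0 hFs
        grind
  have h5 : ∑ a, ∑ b, F a b = ∑ c, (F c i + F c j + F i c + F j c) - F i i - F i j - F j i - F j j := by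
    rw [Finset.sum_congr rfl fun a _ => Finset.sum_congr rfl fun b _ => h3 a b]
    simp only [Finset.sum_add_distrib, Finset.sum_sub_distrib, Finset.sum_ite_eq',
      Finset.mem_univ, if_true]
    have : ∀ (x : Fin n) (f : Fin n → ℤ), ∑ a, ∑ b, (if a = x then f b else 0) = ∑ b, f b := by
      intro x f
      rw [Finset.sum_comm]
      simp
    simp
  rw [h2, h5, Finset.sum_congr rfl fun c _ => h4 c]
  simp only [Finset.sum_add_distrib, Finset.sum_ite_eq', Finset.mem_univ, if_true, hFii, hFjj,
    ← Finset.mul_sum, ← hFs, H]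
  ring

theorem invNum_mul_swap_eq_iff {n : ℕ} (w : Equiv.Perm (Fin n)) {i j : Fin n} (hij : i < j) :
    invNum (w * Equiv.swap i j) = invNum w + 1 ↔
      w i < w j ∧ ∀ c, i < c → c < j → w i < w c → w c < w j → False := by
  have h := invNum_mul_swap_sub w hij
  have hne : w i ≠ w j := fun h => hij.ne (w.injective h)
  rcases lt_or_gt_of_ne hne with hw | hw
  · have e : ∀ c, (if i < c ∧ c < j then
        ((if w i < w c ∧ w c < w j then 1 else 0) -
          (if w j < w c ∧ w c < w i then 1 else 0) : ℤ) else 0) =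
        if (i < c ∧ c < j) ∧ (w i < w c ∧ w c < w j) then 1 else 0 := by
      intro c
      have : ¬ (w j < w c ∧ w c < w i) := fun h => absurd (h.1.trans h.2) hw.not_gt
      simp [this, ite_and]
    rw [Finset.sum_congr rfl fun c _ => e c, if_pos hw, Finset.sum_boole] at h
    constructor
    · intro h1
      refine ⟨hw, fun c h2 h3 h4 h5 => ?_⟩
      have : 0 < #{c | (i < c ∧ c < j) ∧ (w i < w c ∧ w c < w j)} :=
        Finset.card_pos.2 ⟨c, by simp [*]⟩
      push_cast [h1] at h
      omega
    · rintro ⟨-, h1⟩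
      have : #{c | (i < c ∧ c < j) ∧ (w i < w c ∧ w c < w j)} = 0 :=
        Finset.card_eq_zero.2 (Finset.filter_eq_empty_iff.2 fun c _ h2 =>
          h1 c h2.1.1 h2.1.2 h2.2.1 h2.2.2)
      rw [this] at h
      omega
  · have e : (∑ c, if i < c ∧ c < j then
        ((if w i < w c ∧ w c < w j then 1 else 0) -
          (if w j < w c ∧ w c < w i then 1 else 0) : ℤ) else 0) ≤ 0 := by
      refine Finset.sum_nonpos fun c _ => ?_
      have : ¬ (w i < w c ∧ w c < w j) := fun h => absurd (h.1.trans h.2) hw.not_gt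
      simp only [this, if_false]
      split_ifs <;> simp
    rw [if_neg hw.not_gt] at h
    constructor
    · intro h1
      push_cast [h1] at h
      omega
    · rintro ⟨h1, -⟩
      exact absurd h1 hw.not_gt


/-- For `i < j` this is `1` if `l(w t_{ij}) = l(w) + 1` and `0` otherwise; it is antisymmetric in
`i, j`. Auxiliary: the coefficient of `w t_{ij}` in `[i,j] w`. -/
def bruhatSign {n : ℕ} (i j : Fin n) (w : Equiv.Perm (Fin n)) : ℤ :=
  if i < j then if invNum (w * Equiv.swap i j) = invNum w + 1 then 1 else 0
  else -(if invNum (w * Equiv.swap j i) = invNum w + 1 then 1 else 0)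

theorem bruhatSign_antisymm {n : ℕ} {i j : Fin n} (h : i ≠ j) (w : Equiv.Perm (Fin n)) :
    bruhatSign j i w = -bruhatSign i j w := by
  rcases lt_or_gt_of_ne h with h | h <;> simp [bruhatSign, h, h.not_gt]

theorem bruhatSign_mul_self {n : ℕ} (i j : Fin n) (w : Equiv.Perm (Fin n)) :
    bruhatSign i j w * bruhatSign i j (w * Equiv.swap i j) = 0 := by
  simp only [bruhatSign, Equiv.swap_comm j i, mul_assoc, Equiv.swap_mul_self, mul_one]
  split_ifs <;> first | rfl | omega

theorem cover_comm {n : ℕ} {i j k l : Fin n} (hij : i < j) (hkl : k < l) (h1 : i ≠ k) (h2 : i ≠ l)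
    (h3 : j ≠ k) (h4 : j ≠ l) (w : Equiv.Perm (Fin n))
    (ha : invNum (w * Equiv.swap k l) = invNum w + 1)
    (hb : invNum (w * Equiv.swap k l * Equiv.swap i j) = invNum (w * Equiv.swap k l) + 1) :
    invNum (w * Equiv.swap i j) = invNum w + 1 ∧
    invNum (w * Equiv.swap i j * Equiv.swap k l) = invNum (w * Equiv.swap i j) + 1 := by
  rw [invNum_mul_swap_eq_iff _ hij] at hb ⊢
  rw [invNum_mul_swap_eq_iff _ hkl] at ha ⊢
  have inj := w.injective
  simp only [Equiv.Perm.mul_apply, Equiv.swap_apply_def] at *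
  obtain ⟨a1, a2⟩ := ha
  obtain ⟨b1, b2⟩ := hb
  have q1 := a2 i
  have q2 := a2 j
  have q3 := b2 k
  have q4 := b2 l
  refine ⟨⟨by grind, ?_⟩, by grind, ?_⟩
  · intro c c1 c2 c3 c4
    have := b2 c
    have := a2 c
    grind
  · intro c c1 c2 c3 c4
    have := b2 c
    have := a2 c
    grind

theorem bruhatSign_comm_lt {n : ℕ} {i j k l : Fin n} (hij : i < j) (hkl : k < l) (h1 : i ≠ k)
    (h2 : i ≠ l) (h3 : j ≠ k) (h4 : j ≠ l) (w : Equiv.Perm (Fin n)) :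
    bruhatSign k l w * bruhatSign i j (w * Equiv.swap k l) =
      bruhatSign i j w * bruhatSign k l (w * Equiv.swap i j) := by
  have A := cover_comm hij hkl h1 h2 h3 h4 w
  have B := cover_comm hkl hij h1.symm h3.symm h2.symm h4.symm w
  simp only [bruhatSign, if_pos hij, if_pos hkl]
  split_ifs <;> simp_all

theorem bruhatSign_comm {n : ℕ} {i j k l : Fin n} (hij : i ≠ j) (hkl : k ≠ l) (h1 : i ≠ k)
    (h2 : i ≠ l) (h3 : j ≠ k) (h4 : j ≠ l) (w : Equiv.Perm (Fin n)) :
    bruhatSign k l w * bruhatSign i j (w * Equiv.swap k l) =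
      bruhatSign i j w * bruhatSign k l (w * Equiv.swap i j) := by
  rcases lt_or_gt_of_ne hij with hij' | hij' <;> rcases lt_or_gt_of_ne hkl with hkl' | hkl'
  · exact bruhatSign_comm_lt hij' hkl' h1 h2 h3 h4 w
  · simp only [bruhatSign_antisymm hkl.symm, Equiv.swap_comm k l]
    simpa using bruhatSign_comm_lt hij' hkl' h2 h1 h4 h3 w
  · simp only [bruhatSign_antisymm hij.symm, Equiv.swap_comm i j]
    simpa using bruhatSign_comm_lt hij' hkl' h3 h4 h1 h2 w
  · simp only [bruhatSign_antisymm hkl.symm, Equiv.swap_comm k l,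
      bruhatSign_antisymm hij.symm, Equiv.swap_comm i j]
    simpa using bruhatSign_comm_lt hij' hkl' h4 h3 h2 h1 w

theorem ite_three {P P' R R' S S' X a b : Prop} [Decidable P] [Decidable P'] [Decidable R]
    [Decidable R'] [Decidable S] [Decidable S'] (A : P ∧ P' ↔ X) (B : R ∧ R' ↔ a ∧ X)
    (C : S ∧ S' ↔ b ∧ X) (hab : ¬ a ↔ b) :
    (if P then 1 else 0 : ℤ) * (if P' then 1 else 0) -
      (if R then 1 else 0) * (if R' then 1 else 0) -
      (if S then 1 else 0) * (if S' then 1 else 0) = 0 := by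
  by_cases hP : P <;> by_cases hP' : P' <;> by_cases hR : R <;> by_cases hR' : R' <;>
    by_cases hS : S <;> by_cases hS' : S' <;>
    simp only [hP, hP', hR, hR', hS, hS', if_true, if_false] <;> simp <;> grind

theorem bruhatSign_three_lt {n : ℕ} {i j k : Fin n} (hij : i < j) (hjk : j < k)
    (w : Equiv.Perm (Fin n)) :
    bruhatSign j k w * bruhatSign i j (w * Equiv.swap j k) +
      bruhatSign k i w * bruhatSign j k (w * Equiv.swap k i) +
      bruhatSign i j w * bruhatSign k i (w * Equiv.swap i j) = 0 := by
  have hik := hij.trans hjk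
  have hne : w i ≠ w j := fun h => hij.ne (w.injective h)
  have inj := w.injective
  have key := @ite_three _ _ _ _ _ _
    (w j < w k ∧ w i < w k ∧ (∀ c, j < c → c < k → w j < w c → w c < w k → False) ∧
      (∀ c, i < c → c < j → w i < w c → w c < w k → False)) (w i < w j) (w j < w i)
    (instDecidableEqNat (invNum (w * Equiv.swap j k)) (invNum w + 1))
    (instDecidableEqNat (invNum (w * Equiv.swap j k * Equiv.swap i j))
      (invNum (w * Equiv.swap j k) + 1))
    (instDecidableEqNat (invNum (w * Equiv.swap i j)) (invNum w + 1))
    (instDecidableEqNat (invNum (w * Equiv.swap i j * Equiv.swap i k))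
      (invNum (w * Equiv.swap i j) + 1))
    (instDecidableEqNat (invNum (w * Equiv.swap i k)) (invNum w + 1))
    (instDecidableEqNat (invNum (w * Equiv.swap i k * Equiv.swap j k))
      (invNum (w * Equiv.swap i k) + 1)) ?_ ?_ ?_ ?_
  · simp only [bruhatSign, if_pos hij, if_pos hjk, if_neg hik.not_gt, Equiv.swap_comm k i]
    linear_combination key
  · rw [invNum_mul_swap_eq_iff _ hij, invNum_mul_swap_eq_iff _ hjk]
    simp only [Equiv.Perm.mul_apply, Equiv.swap_apply_def]
    grind
  · rw [invNum_mul_swap_eq_iff _ hij, invNum_mul_swap_eq_iff _ hik]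
    simp only [Equiv.Perm.mul_apply, Equiv.swap_apply_def]
    constructor
    · rintro ⟨⟨h1, h2⟩, h3, h4⟩
      refine ⟨by grind, by grind, by grind, fun c => ?_, fun c => ?_⟩ <;>
        have := h2 c <;> have := h4 c <;> grind
    · rintro ⟨h1, h0, h2, h3, h4⟩
      refine ⟨⟨by grind, fun c => ?_⟩, by grind, fun c => ?_⟩ <;>
        have := h3 c <;> have := h4 c <;> grind
  · rw [invNum_mul_swap_eq_iff _ hik, invNum_mul_swap_eq_iff _ hjk]
    simp only [Equiv.Perm.mul_apply, Equiv.swap_apply_def]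
    constructor
    · rintro ⟨⟨h1, h2⟩, h3, h4⟩
      refine ⟨by grind, by grind, by grind, fun c => ?_, fun c => ?_⟩ <;>
        have := h2 c <;> have := h4 c <;> grind
    · rintro ⟨h1, h0, h2, h3, h4⟩
      refine ⟨⟨by grind, fun c => ?_⟩, by grind, fun c => ?_⟩ <;>
        have := h3 c <;> have := h4 c <;> grind
  · grind

theorem bruhatSign_three_gt {n : ℕ} {i j k : Fin n} (hij : i < j) (hjk : j < k)
    (w : Equiv.Perm (Fin n)) :
    bruhatSign j i w * bruhatSign k j (w * Equiv.swap j i) +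
      bruhatSign i k w * bruhatSign j i (w * Equiv.swap i k) +
      bruhatSign k j w * bruhatSign i k (w * Equiv.swap k j) = 0 := by
  have hik := hij.trans hjk
  have hne : w j ≠ w k := fun h => hjk.ne (w.injective h)
  have inj := w.injective
  have key := @ite_three _ _ _ _ _ _
    (w i < w j ∧ w i < w k ∧ (∀ c, j < c → c < k → w i < w c → w c < w k → False) ∧
      (∀ c, i < c → c < j → w i < w c → w c < w j → False)) (w j < w k) (w k < w j)
    (instDecidableEqNat (invNum (w * Equiv.swap i j)) (invNum w + 1))
    (instDecidableEqNat (invNum (w * Equiv.swap i j * Equiv.swap j k))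
      (invNum (w * Equiv.swap i j) + 1))
    (instDecidableEqNat (invNum (w * Equiv.swap j k)) (invNum w + 1))
    (instDecidableEqNat (invNum (w * Equiv.swap j k * Equiv.swap i k))
      (invNum (w * Equiv.swap j k) + 1))
    (instDecidableEqNat (invNum (w * Equiv.swap i k)) (invNum w + 1))
    (instDecidableEqNat (invNum (w * Equiv.swap i k * Equiv.swap i j))
      (invNum (w * Equiv.swap i k) + 1)) ?_ ?_ ?_ ?_
  · simp only [bruhatSign, if_neg hij.not_gt, if_neg hjk.not_gt, if_pos hik,
      Equiv.swap_comm k j, Equiv.swap_comm j i]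
    linear_combination key
  · rw [invNum_mul_swap_eq_iff _ hij, invNum_mul_swap_eq_iff _ hjk]
    simp only [Equiv.Perm.mul_apply, Equiv.swap_apply_def]
    grind
  · rw [invNum_mul_swap_eq_iff _ hik, invNum_mul_swap_eq_iff _ hjk]
    simp only [Equiv.Perm.mul_apply, Equiv.swap_apply_def]
    constructor
    · rintro ⟨⟨h1, h2⟩, h3, h4⟩
      refine ⟨by grind, by grind, by grind, fun c => ?_, fun c => ?_⟩ <;>
        have := h2 c <;> have := h4 c <;> grind
    · rintro ⟨h1, h0, h2, h3, h4⟩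
      refine ⟨⟨by grind, fun c => ?_⟩, by grind, fun c => ?_⟩ <;>
        have := h3 c <;> have := h4 c <;> grind
  · rw [invNum_mul_swap_eq_iff _ hik, invNum_mul_swap_eq_iff _ hij]
    simp only [Equiv.Perm.mul_apply, Equiv.swap_apply_def]
    constructor
    · rintro ⟨⟨h1, h2⟩, h3, h4⟩
      refine ⟨by grind, by grind, by grind, fun c => ?_, fun c => ?_⟩ <;>
        have := h2 c <;> have := h4 c <;> grind
    · rintro ⟨h1, h0, h2, h3, h4⟩
      refine ⟨⟨by grind, fun c => ?_⟩, by grind, fun c => ?_⟩ <;>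
        have := h3 c <;> have := h4 c <;> grind
  · grind

theorem bruhatSign_three {n : ℕ} {i j k : Fin n} (hij : i ≠ j) (hjk : j ≠ k) (hik : i ≠ k)
    (w : Equiv.Perm (Fin n)) :
    bruhatSign j k w * bruhatSign i j (w * Equiv.swap j k) +
      bruhatSign k i w * bruhatSign j k (w * Equiv.swap k i) +
      bruhatSign i j w * bruhatSign k i (w * Equiv.swap i j) = 0 := by
  rcases lt_or_gt_of_ne hij with h1 | h1 <;> rcases lt_or_gt_of_ne hjk with h2 | h2 <;>
    rcases lt_or_gt_of_ne hik with h3 | h3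
  · exact bruhatSign_three_lt h1 h2 w
  · exact absurd (h1.trans h2) h3.not_gt
  · have := bruhatSign_three_gt h3 h2 w
    linarith
  · have := bruhatSign_three_lt h3 h1 w
    linarith
  · have := bruhatSign_three_gt h1 h3 w
    linarith
  · have := bruhatSign_three_lt h2 h3 w
    linarith
  · exact absurd (h2.trans h1) h3.not_gt
  · have := bruhatSign_three_gt h2 h1 w
    linarith

end Length

/-! ### Divided differences -/

noncomputable section

theorem X_sub_X_dvd {n : ℕ} {k : Type*} [CommRing k] (a b : Fin n)
    (f : MvPolynomial (Fin n) k) :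
    (MvPolynomial.X a - MvPolynomial.X b) ∣ f - MvPolynomial.rename (Equiv.swap a b) f := by
  induction f using MvPolynomial.induction_on with
  | C c => simp
  | add p q hp hq =>
    have := dvd_add hp hq
    rw [map_add]
    convert this using 1
    ring
  | mul_X p m hp =>
    have h : (MvPolynomial.X a - MvPolynomial.X b : MvPolynomial (Fin n) k) ∣
        MvPolynomial.X m - MvPolynomial.X (Equiv.swap a b m) := by
      rw [Equiv.swap_apply_def]
      split_ifs with h1 h2
      · subst h1; exact dvd_refl _
      · subst h2; exact (dvd_sub_comm).1 (dvd_refl _)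
      · simp
    have := dvd_add (hp.mul_right (MvPolynomial.X m))
      (h.mul_left (MvPolynomial.rename (Equiv.swap a b) p))
    rw [map_mul, MvPolynomial.rename_X]
    convert this using 1
    ring

theorem X_sub_X_ne_zero {n : ℕ} {k : Type*} [CommRing k] [IsDomain k] {a b : Fin n}
    (h : a ≠ b) : (MvPolynomial.X a - MvPolynomial.X b : MvPolynomial (Fin n) k) ≠ 0 :=
  sub_ne_zero.2 fun e => h (MvPolynomial.X_injective e)

/-- The divided difference operator `∂_{ab} f = (f - t_{ab} f) / (y_a - y_b)` (exact division) on
polynomials, where `t_{ab}` exchanges the variables `y_a` and `y_b`; it is `0` for `a = b`. -/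
def divDiff {n : ℕ} (k : Type*) [CommRing k] [IsDomain k] (a b : Fin n) :
    MvPolynomial (Fin n) k →ₗ[k] MvPolynomial (Fin n) k where
  toFun f := if a = b then 0 else (X_sub_X_dvd a b f).choose
  map_add' f g := by
    split_ifs with h
    · simp
    · apply mul_left_cancel₀ (X_sub_X_ne_zero (k := k) h)
      rw [mul_add, ← (X_sub_X_dvd a b f).choose_spec, ← (X_sub_X_dvd a b g).choose_spec,
        ← (X_sub_X_dvd a b (f + g)).choose_spec, map_add]
      ring
  map_smul' c f := by
    split_ifs with h
    · simp
    · apply mul_left_cancel₀ (X_sub_X_ne_zero (k := k) h)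
      rw [RingHom.id_apply, mul_smul_comm, ← (X_sub_X_dvd a b f).choose_spec,
        ← (X_sub_X_dvd a b (c • f)).choose_spec, map_smul, smul_sub]

theorem X_sub_X_mul_divDiff {n : ℕ} {k : Type*} [CommRing k] [IsDomain k] {a b : Fin n}
    (h : a ≠ b) (f : MvPolynomial (Fin n) k) :
    (MvPolynomial.X a - MvPolynomial.X b) * divDiff k a b f =
      f - MvPolynomial.rename (Equiv.swap a b) f := by
  simp only [divDiff, LinearMap.coe_mk, AddHom.coe_mk, if_neg h]
  exact (X_sub_X_dvd a b f).choose_spec.symm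

/-! ### Reduced words -/

/-- The simple transposition `s_i` (`i : Fin (n - 1)`) exchanges `adjLeft i = i` and
`adjRight i = i + 1`. -/
def adjLeft {n : ℕ} (i : Fin (n - 1)) : Fin n := ⟨i, by omega⟩

/-- See `adjLeft`. -/
def adjRight {n : ℕ} (i : Fin (n - 1)) : Fin n := ⟨i + 1, by omega⟩

theorem adjLeft_lt_adjRight {n : ℕ} (i : Fin (n - 1)) : adjLeft i < adjRight i := by
  simp [adjLeft, adjRight]

/-- The word `i₁, …, i_r` is a reduced decomposition of `w`: `w = s_{i₁} ⋯ s_{i_r}` with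
`r = l(w)`. -/
def IsReducedWord {n : ℕ} (l : List (Fin (n - 1))) (w : Equiv.Perm (Fin n)) : Prop :=
  (l.map fun i => Equiv.swap (adjLeft i) (adjRight i)).prod = w ∧ l.length = invNum w

theorem exists_isReducedWord {n : ℕ} (w : Equiv.Perm (Fin n)) :
    ∃ l, IsReducedWord l w := by
  obtain ⟨m, hm⟩ : ∃ m, invNum w = m := ⟨_, rfl⟩
  induction m generalizing w with
  | zero =>
    refine ⟨[], ?_, by simp [hm]⟩
    have hmono : Monotone w := by
      intro a b hab
      by_contra h
      rw [not_le] at h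
      rw [invNum, Finset.card_eq_zero, Finset.filter_eq_empty_iff] at hm
      have : a ≠ b := by rintro rfl; exact lt_irrefl _ h
      exact hm (x := (a, b)) (Finset.mem_univ _) ⟨lt_of_le_of_ne hab this, h⟩
    have hs : StrictMono w := hmono.strictMono_of_injective w.injective
    have : ∀ a, w a = a := by
      have := Subsingleton.elim (hs.orderIsoOfSurjective w w.surjective) (OrderIso.refl _)
      intro a
      exact congrArg (fun e : Fin n ≃o Fin n => e a) this
    ext a
    simp [this]
  | succ m ih =>
    by_cases hd : ∃ i : Fin (n - 1), w (adjRight i) < w (adjLeft i)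
    · obtain ⟨i, hi⟩ := hd
      set s := Equiv.swap (adjLeft i) (adjRight i) with hs
      have h : invNum (w * s * s) = invNum (w * s) + 1 := by
        rw [hs, invNum_mul_swap_eq_iff _ (adjLeft_lt_adjRight i)]
        refine ⟨by simpa using hi, fun c h1 h2 => ?_⟩
        simp only [adjLeft, adjRight, Fin.lt_def] at h1 h2
        omega
      have hss : w * s * s = w := by simp [hs, mul_assoc]
      rw [hss] at h
      obtain ⟨l, hl1, hl2⟩ := ih (w * s) (by omega)
      refine ⟨l ++ [i], ?_, ?_⟩
      · rw [List.map_append, List.prod_append, hl1]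
        simpa using hss
      · simp [hl2, h]
    · exfalso
      push Not at hd
      have hmono : Monotone w := by
        cases n with
        | zero => exact fun a => a.elim0
        | succ n => exact Fin.monotone_iff_le_succ.2 fun i => hd i
      rw [invNum, Finset.filter_eq_empty_iff.2] at hm
      · simp at hm
      · rintro ⟨a, b⟩ - ⟨h1, h2⟩
        exact (hmono h1.le).not_gt h2

/-- A reduced decomposition of `w`. -/
def reducedWord {n : ℕ} (w : Equiv.Perm (Fin n)) : List (Fin (n - 1)) :=
  (exists_isReducedWord w).choose

/-- `∂_w = ∂_{i₁} ⋯ ∂_{i_r}` for a reduced decomposition `w = s_{i₁} ⋯ s_{i_r}`, where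
`∂_i = ∂_{i,i+1}`. By the Coxeter relations of the `∂_i` it does not depend on the decomposition
that was chosen. -/
def divDiffPerm {n : ℕ} (k : Type*) [CommRing k] [IsDomain k] (w : Equiv.Perm (Fin n))
    (f : MvPolynomial (Fin n) k) : MvPolynomial (Fin n) k :=
  (reducedWord w).foldr (fun i g => divDiff k (adjLeft i) (adjRight i) g) f

/-- `∏_{i + j ≤ n} (x_i - y_j)`, with `i, j` counted from `1`. Polynomials in `x` and `y` are
polynomials in `x` with coefficients in `ℤ[y]`. -/
def doubleSchubertTop (n : ℕ) : MvPolynomial (Fin n) (MvPolynomial (Fin n) ℤ) :=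
  ∏ p : Fin n × Fin n with ((p.1 : ℕ) + 1) + ((p.2 : ℕ) + 1) ≤ n,
    (MvPolynomial.X p.1 - MvPolynomial.C (MvPolynomial.X p.2))

/-- The double Schubert polynomial `𝔖_w(x, y) = ∂_{w⁻¹ w₀} ∏_{i + j ≤ n} (x_i - y_j)`, the divided
differences acting on the variables `x`; the longest element `w₀` is `Fin.revPerm`. -/
def doubleSchubert {n : ℕ} (w : Equiv.Perm (Fin n)) :
    MvPolynomial (Fin n) (MvPolynomial (Fin n) ℤ) :=
  divDiffPerm (MvPolynomial (Fin n) ℤ) (w⁻¹ * Fin.revPerm) (doubleSchubertTop n)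

/-! ### The extended quadratic algebra -/

/-- The value `p(v_0, …, v_{n-1})` of a polynomial at elements of a possibly noncommutative algebra,
each monomial being multiplied out in the order `v_0 ^ m_0 * ⋯ * v_{n-1} ^ m_{n-1}`. It is used only
for the `x_k` and for the Dunkl elements; both commute pairwise in the algebra defined below, so the
order is immaterial. -/
def ncEval {n : ℕ} {B S : Type*} [CommSemiring B] [Semiring S] [Algebra B S] (v : Fin n → S)
    (p : MvPolynomial (Fin n) B) : S :=
  ∑ m ∈ p.support, p.coeff m • (List.ofFn fun i => v i ^ m i).prod

/-- The generators `[i,j]`, `i ≠ j`, and `x_k`. -/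
inductive EGen (n : ℕ) : Type
  | br (i j : Fin n) (h : i ≠ j) : EGen n
  | x (k : Fin n) : EGen n

open FreeAlgebra in
/-- The defining relations of the extended quadratic algebra over `k[y_0, …, y_{n-1}]`, with
parameter `t : k`. -/
inductive ETildeRel (n : ℕ) (k : Type*) [CommRing k] (t : k) :
    FreeAlgebra (MvPolynomial (Fin n) k) (EGen n) →
    FreeAlgebra (MvPolynomial (Fin n) k) (EGen n) → Prop
  | antisymm (i j : Fin n) (h : i ≠ j) :
      ETildeRel n k t (ι _ (.br i j h)) (-ι _ (.br j i h.symm))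
  | sq (i j : Fin n) (h : i ≠ j) :
      ETildeRel n k t (ι _ (.br i j h) * ι _ (.br i j h)) 0
  | comm (i j a b : Fin n) (h : i ≠ j) (h' : a ≠ b)
      (hd : Disjoint ({i, j} : Set (Fin n)) {a, b}) :
      ETildeRel n k t (ι _ (.br i j h) * ι _ (.br a b h')) (ι _ (.br a b h') * ι _ (.br i j h))
  | three (i j a : Fin n) (h₁ : i ≠ j) (h₂ : j ≠ a) (h₃ : a ≠ i) :
      ETildeRel n k t
        (ι _ (.br i j h₁) * ι _ (.br j a h₂) + ι _ (.br j a h₂) * ι _ (.br a i h₃) +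
          ι _ (.br a i h₃) * ι _ (.br i j h₁)) 0
  | x_comm (a b : Fin n) :
      ETildeRel n k t (ι _ (.x a) * ι _ (.x b)) (ι _ (.x b) * ι _ (.x a))
  | br_x (i j a : Fin n) (h : i ≠ j) (hi : a ≠ i) (hj : a ≠ j) :
      ETildeRel n k t (ι _ (.br i j h) * ι _ (.x a)) (ι _ (.x a) * ι _ (.br i j h))
  | br_x_left (i j : Fin n) (h : i < j) :
      ETildeRel n k t (ι _ (.br i j h.ne) * ι _ (.x i))
        (ι _ (.x j) * ι _ (.br i j h.ne) + algebraMap (MvPolynomial (Fin n) k) _ (MvPolynomial.C t))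
  | br_x_right (i j : Fin n) (h : i < j) :
      ETildeRel n k t (ι _ (.br i j h.ne) * ι _ (.x j))
        (ι _ (.x i) * ι _ (.br i j h.ne) - algebraMap (MvPolynomial (Fin n) k) _ (MvPolynomial.C t))
  | esymm (r : ℕ) (h₁ : 1 ≤ r) (h₂ : r ≤ n) :
      ETildeRel n k t
        (ncEval (fun a => ι (MvPolynomial (Fin n) k) (.x a))
          (MvPolynomial.esymm (Fin n) (MvPolynomial (Fin n) k) r))
        (algebraMap (MvPolynomial (Fin n) k) _ (MvPolynomial.esymm (Fin n) k r))

/-- The extended quadratic algebra over `k[y]`, generated by `[i,j]` and `x_k`, in which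
`e_r(x) = e_r(y)`. For `k = ℤ[t]` with its variable `t` it is the algebra with `t` a central
variable, and for `k = ℤ`, `t = t₀` its specialization at `t = t₀`. -/
def ETilde (n : ℕ) (k : Type*) [CommRing k] (t : k) : Type _ :=
  RingQuot (ETildeRel n k t)

namespace ETilde

variable {n : ℕ} {k : Type*} [CommRing k] {t : k}

instance : Ring (ETilde n k t) := inferInstanceAs (Ring (RingQuot (ETildeRel n k t)))

instance : Algebra (MvPolynomial (Fin n) k) (ETilde n k t) :=
  inferInstanceAs (Algebra (MvPolynomial (Fin n) k) (RingQuot (ETildeRel n k t)))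

/-- The quotient map from the free algebra. -/
def mk (n : ℕ) {k : Type*} [CommRing k] (t : k) :
    FreeAlgebra (MvPolynomial (Fin n) k) (EGen n) →ₐ[MvPolynomial (Fin n) k] ETilde n k t :=
  RingQuot.mkAlgHom (MvPolynomial (Fin n) k) (ETildeRel n k t)

theorem mk_rel {a b : FreeAlgebra (MvPolynomial (Fin n) k) (EGen n)} (h : ETildeRel n k t a b) :
    mk n t a = mk n t b :=
  RingQuot.mkAlgHom_rel _ h

/-- The generator `[i,j]`. -/
def br (t : k) (i j : Fin n) (h : i ≠ j) : ETilde n k t :=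
  mk n t (FreeAlgebra.ι _ (.br i j h))

/-- The generator `x_a`. -/
def x (t : k) (a : Fin n) : ETilde n k t :=
  mk n t (FreeAlgebra.ι _ (.x a))

/-- The Dunkl element `θ_i = x_i + ∑_{j ≠ i} [i,j]`. -/
def dunkl (t : k) (i : Fin n) : ETilde n k t :=
  x t i + ∑ j : {j : Fin n // i ≠ j}, br t i j j.2

/-- The Dunkl elements commute pairwise, so that polynomials can be evaluated at them. -/
theorem dunkl_commute (i j : Fin n) : Commute (dunkl t i) (dunkl t j) := by
  rcases eq_or_ne i j with rfl | hij
  · exact Commute.refl _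
  let B : Fin n → Fin n → ETilde n k t := fun a b => if h : a ≠ b then br t a b h else 0
  have hB : ∀ a b (h : a ≠ b), B a b = br t a b h := fun a b h => dif_pos h
  have hB0 : ∀ a, B a a = 0 := fun a => dif_neg (by simp)
  have hD : ∀ a, dunkl t a = x t a + ∑ b, B a b := by
    intro a
    rw [dunkl]
    congr 1
    rw [← Finset.sum_filter_add_sum_filter_not _ (fun b => a ≠ b)]
    rw [Finset.sum_eq_zero (s := {b | ¬ a ≠ b}), add_zero]
    · rw [← Finset.sum_subtype_of_mem (p := fun b => a ≠ b)]
      · refine Finset.sum_bij (fun b _ => ⟨b.1, b.2⟩) ?_ ?_ ?_ ?_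
        · simp
        · simp
        · rintro ⟨b, hb⟩ _; exact ⟨⟨b, hb⟩, by simp, rfl⟩
        · rintro ⟨b, hb⟩ _; exact (hB _ _ hb).symm
      · simp
    · intro b hb
      have : a = b := by simpa using hb
      rw [← this, hB0]
  have anti : ∀ a b, B a b = -B b a := by
    intro a b
    rcases eq_or_ne a b with rfl | h
    · simp [hB0]
    · rw [hB a b h, hB b a h.symm, br, br, ← map_neg]
      exact mk_rel (.antisymm a b h)
  have comm : ∀ a b c d, a ≠ c → a ≠ d → b ≠ c → b ≠ d → B a b * B c d = B c d * B a b := by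
    intro a b c d h1 h2 h3 h4
    rcases eq_or_ne a b with rfl | h
    · simp [hB0]
    rcases eq_or_ne c d with rfl | h'
    · simp [hB0]
    rw [hB a b h, hB c d h', br, br, ← map_mul, ← map_mul]
    exact mk_rel (.comm a b c d h h' (by
      rw [Set.disjoint_left]; rintro z (rfl | rfl) (rfl | rfl) <;> contradiction))
  have three : ∀ a b c, a ≠ b → b ≠ c → c ≠ a →
      B a b * B b c + B b c * B c a + B c a * B a b = 0 := by
    intro a b c h1 h2 h3
    rw [hB a b h1, hB b c h2, hB c a h3, br, br, br, ← map_mul, ← map_mul, ← map_mul, ← map_add,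
      ← map_add, ← map_zero (mk n t)]
    exact mk_rel (.three a b c h1 h2 h3)
  have xx : x t i * x t j = x t j * x t i := by
    rw [x, x, ← map_mul, ← map_mul]
    exact mk_rel (.x_comm i j)
  have bx : ∀ a b c, c ≠ a → c ≠ b → B a b * x t c = x t c * B a b := by
    intro a b c h1 h2
    rcases eq_or_ne a b with rfl | h
    · simp [hB0]
    rw [hB a b h, br, x, ← map_mul, ← map_mul]
    exact mk_rel (.br_x a b c h h1 h2)
  have bxx' : ∀ a b, a < b → B a b * (x t a + x t b) = (x t a + x t b) * B a b := by
    intro a b h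
    have h1 : B a b * x t a = x t b * B a b +
        algebraMap (MvPolynomial (Fin n) k) _ (MvPolynomial.C t) := by
      rw [hB a b h.ne, br, x, x, ← map_mul, ← map_mul]
      refine (mk_rel (.br_x_left a b h)).trans ?_
      rw [map_add, AlgHom.commutes]
    have h2 : B a b * x t b = x t a * B a b -
        algebraMap (MvPolynomial (Fin n) k) _ (MvPolynomial.C t) := by
      rw [hB a b h.ne, br, x, x, ← map_mul, ← map_mul]
      refine (mk_rel (.br_x_right a b h)).trans ?_
      rw [map_sub, AlgHom.commutes]
    rw [mul_add, h1, h2]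
    noncomm_ring
  have bxx : B i j * (x t i + x t j) = (x t i + x t j) * B i j := by
    rcases lt_or_gt_of_ne hij with h | h
    · exact bxx' i j h
    · have := bxx' j i h
      rw [anti i j, add_comm (x t i)]
      simp only [neg_mul, mul_neg, this]
  have G : ∀ a b, B i a * B j b - B j b * B i a =
      (if a = j then B i j * B j b - B j b * B i j else 0) +
      (if b = i then B i a * B j i - B j i * B i a else 0) +
      (if a = b then B i a * B j a - B j a * B i a else 0) := by
    intro a b
    by_cases h1 : a = j
    · subst h1
      by_cases h2 : b = i
      · subst h2
        simp [hij.symm, anti a b]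
      · by_cases h3 : a = b
        · subst h3; simp [hij.symm, hB0]
        · simp [h2, h3]
    · by_cases h2 : b = i
      · subst h2
        by_cases h3 : a = b
        · subst h3; simp [h1, hB0]
        · simp [h1, h3]
      · by_cases h3 : a = b
        · subst h3; simp [h1, h2]
        · rcases eq_or_ne b j with rfl | h4
          · simp [hB0, h1, h2]
          rcases eq_or_ne a i with rfl | h5
          · simp [hB0, h1, h2, h3]
          simp only [h1, h2, h3, if_false, add_zero]
          rw [comm i a j b hij (Ne.symm h2) h1 h3, sub_self]
  have dsum : ∑ a, ∑ b, (B i a * B j b - B j b * B i a) = 0 := by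
    have hpt : ∀ m, (B i j * B j m - B j m * B i j) + (B i m * B j i - B j i * B i m) +
        (B i m * B j m - B j m * B i m) = 0 := by
      intro m
      rcases eq_or_ne m i with rfl | h1
      · simp [hB0, anti j m]
      rcases eq_or_ne m j with rfl | h2
      · simp [hB0, anti m i]
      have e1 := three i j m hij h2.symm h1
      have e2 := three m j i h2 hij.symm h1.symm
      rw [anti m i] at e1
      rw [anti m j] at e2
      have e3 := anti j i
      rw [e3] at e2 ⊢
      have : (B i j * B j m - B j m * B i j) + (B i m * -B i j - -B i j * B i m) +
        (B i m * B j m - B j m * B i m) = (B i j * B j m + B j m * -B i m + -B i m * B i j)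
        - (-B j m * -B i j + -B i j * B i m + B i m * -B j m) := by
        noncomm_ring
      rw [this, e1, e2, sub_self]
    rw [Finset.sum_congr rfl fun a _ => Finset.sum_congr rfl fun b _ => G a b]
    simp only [Finset.sum_add_distrib, Finset.sum_ite_eq, Finset.sum_ite_eq', Finset.mem_univ,
      if_true]
    rw [Finset.sum_comm]
    simp only [Finset.sum_ite_eq', Finset.mem_univ, if_true]
    rw [← Finset.sum_add_distrib, ← Finset.sum_add_distrib]
    exact Finset.sum_eq_zero fun m _ => hpt m
  have s1 : ∑ b, (x t i * B j b - B j b * x t i) = x t i * B j i - B j i * x t i := by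
    refine Finset.sum_eq_single i (fun b _ hb => ?_) (by simp)
    rw [bx j b i hij hb.symm, sub_self]
  have s2 : ∑ a, (B i a * x t j - x t j * B i a) = B i j * x t j - x t j * B i j := by
    refine Finset.sum_eq_single j (fun b _ hb => ?_) (by simp)
    rw [bx i b j hij.symm hb.symm, sub_self]
  have e : (x t i + ∑ b, B i b) * (x t j + ∑ b, B j b) -
      (x t j + ∑ b, B j b) * (x t i + ∑ b, B i b) =
      (x t i * x t j - x t j * x t i) + ∑ b, (x t i * B j b - B j b * x t i) +
      ∑ a, (B i a * x t j - x t j * B i a) + ∑ a, ∑ b, (B i a * B j b - B j b * B i a) := by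
    have e1 : ∑ a, ∑ b, (B i a * B j b - B j b * B i a) =
        (∑ b, B i b) * (∑ b, B j b) - (∑ b, B j b) * ∑ b, B i b := by
      rw [Finset.sum_mul_sum, Finset.sum_mul_sum, Finset.sum_comm (f := fun a b => B j a * B i b)]
      simp only [Finset.sum_sub_distrib]
    rw [e1, Finset.sum_sub_distrib, Finset.sum_sub_distrib, ← Finset.mul_sum, ← Finset.mul_sum,
      ← Finset.sum_mul, ← Finset.sum_mul]
    noncomm_ring
  rw [Commute, SemiconjBy, hD, hD, ← sub_eq_zero, e, dsum, s1, s2, xx, anti j i]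
  refine Eq.trans ?_ (sub_eq_zero.2 bxx)
  noncomm_ring

end ETilde

/-! ### The extended Bruhat representation -/

/-- `k[y]⟨S_n⟩`, the free `k[y]`-module with basis `S_n`; the basis element of `w` is
`Finsupp.single w 1`. -/
abbrev BruhatModule (n : ℕ) (k : Type*) [CommRing k] : Type _ :=
  Equiv.Perm (Fin n) →₀ MvPolynomial (Fin n) k

section
variable {n : ℕ} {k : Type*} [CommRing k]

/-- The operator `σ̃_{ij}` (used for `i < j`): it maps `f w` to
`t (∂_{w(i) w(j)} f) w + f (w t_{ij})` if `l(w t_{ij}) = l(w) + 1` and to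
`t (∂_{w(i) w(j)} f) w` otherwise. -/
def sigmaTilde [IsDomain k] (t : k) (i j : Fin n) : BruhatModule n k →ₗ[k] BruhatModule n k :=
  Finsupp.lsum k fun w =>
    t • (Finsupp.lsingle w ∘ₗ divDiff k (w i) (w j)) +
      if invNum (w * Equiv.swap i j) = invNum w + 1 then
        (Finsupp.lsingle (w * Equiv.swap i j) : MvPolynomial (Fin n) k →ₗ[k] BruhatModule n k)
      else 0

/-- The action of `[i,j]`: `σ̃_{ij}` for `i < j`, and `-σ̃_{ji}` for `j < i`. -/
def bracketOp [IsDomain k] (t : k) (i j : Fin n) : BruhatModule n k →ₗ[k] BruhatModule n k :=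
  if i < j then sigmaTilde t i j else -sigmaTilde t j i

/-- The operator `ξ_a`, which maps `f w` to `y_{w(a)} f w`. -/
def xiOp (k : Type*) [CommRing k] (a : Fin n) :
    BruhatModule n k →ₗ[MvPolynomial (Fin n) k] BruhatModule n k :=
  Finsupp.lsum (MvPolynomial (Fin n) k) fun w =>
    (MvPolynomial.X (w a) : MvPolynomial (Fin n) k) • Finsupp.lsingle w

theorem xiOp_single (a : Fin n) (w : Equiv.Perm (Fin n)) (f : MvPolynomial (Fin n) k) :
    xiOp k a (Finsupp.single w f) = Finsupp.single w (MvPolynomial.X (w a) * f) := by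
  simp [xiOp]

theorem bracketOp_zero_single [IsDomain k] (i j : Fin n) (w : Equiv.Perm (Fin n))
    (f : MvPolynomial (Fin n) k) :
    bracketOp (0 : k) i j (Finsupp.single w f) =
      Finsupp.single (w * Equiv.swap i j) ((bruhatSign i j w : MvPolynomial (Fin n) k) * f) := by
  simp only [bracketOp, sigmaTilde, bruhatSign]
  rw [Equiv.swap_comm j i]
  split_ifs with h1 <;> simp [*]

/-- At `t = 0` the action of `[i,j]` is `k[y]`-linear. -/
def bracketOpZero [IsDomain k] (i j : Fin n) :
    BruhatModule n k →ₗ[MvPolynomial (Fin n) k] BruhatModule n k :=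
  { bracketOp (0 : k) i j with
    map_smul' := by
      intro c v
      induction v using Finsupp.induction_linear with
      | zero => simp
      | add f g hf hg =>
        simp only [AddHom.toFun_eq_coe, LinearMap.coe_toAddHom, RingHom.id_apply] at hf hg ⊢
        rw [smul_add, map_add, hf, hg, map_add, smul_add]
      | single w f =>
        simp only [AddHom.toFun_eq_coe, LinearMap.coe_toAddHom, RingHom.id_apply,
          Finsupp.smul_single, bracketOp_zero_single, smul_eq_mul]
        rw [mul_left_comm] }

theorem bracketOpZero_single [IsDomain k] (i j : Fin n) (w : Equiv.Perm (Fin n))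
    (f : MvPolynomial (Fin n) k) :
    bracketOpZero i j (Finsupp.single w f) =
      Finsupp.single (w * Equiv.swap i j) ((bruhatSign i j w : MvPolynomial (Fin n) k) * f) :=
  bracketOp_zero_single i j w f

theorem ncEval_xiOp (p : MvPolynomial (Fin n) (MvPolynomial (Fin n) k))
    (w : Equiv.Perm (Fin n)) (f : MvPolynomial (Fin n) k) :
    (ncEval (S := Module.End (MvPolynomial (Fin n) k) (BruhatModule n k)) (xiOp k) p)
      (Finsupp.single w f) =
      Finsupp.single w (MvPolynomial.eval (fun a => MvPolynomial.X (w a)) p * f) := by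
  have hpow : ∀ (a : Fin n) (r : ℕ) (f : MvPolynomial (Fin n) k),
      ((xiOp k a : Module.End _ (BruhatModule n k)) ^ r) (Finsupp.single w f) =
        Finsupp.single w (MvPolynomial.X (w a) ^ r * f) := by
    intro a r
    induction r with
    | zero => simp
    | succ r ih =>
      intro f
      rw [pow_succ, Module.End.mul_apply, xiOp_single, ih, pow_succ, mul_assoc]
  have hlist : ∀ (l : List (Fin n)) (m : Fin n → ℕ) (f : MvPolynomial (Fin n) k),
      (l.map fun a => (xiOp k a : Module.End _ (BruhatModule n k)) ^ m a).prod
        (Finsupp.single w f) =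
      Finsupp.single w ((l.map fun a =>
        (MvPolynomial.X (w a) : MvPolynomial (Fin n) k) ^ m a).prod * f) := by
    intro l m
    induction l with
    | nil => simp
    | cons a l ih =>
      intro f
      rw [List.map_cons, List.prod_cons, Module.End.mul_apply, ih, hpow, List.map_cons,
        List.prod_cons, mul_assoc]
  rw [ncEval, LinearMap.sum_apply, MvPolynomial.eval_eq', Finset.sum_mul,
    Finsupp.single_finsetSum]
  refine Finset.sum_congr rfl fun m _ => ?_
  rw [LinearMap.smul_apply, List.ofFn_eq_map, hlist, Finsupp.smul_single, smul_eq_mul,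
    ← List.ofFn_eq_map, List.prod_ofFn, mul_assoc]

theorem map_ncEval {B S T : Type*} [CommSemiring B] [Semiring S] [Semiring T] [Algebra B S]
    [Algebra B T] (φ : S →ₐ[B] T) (v : Fin n → S) (p : MvPolynomial (Fin n) B) :
    φ (ncEval v p) = ncEval (fun a => φ (v a)) p := by
  simp only [ncEval, map_sum, map_smul, map_list_prod, List.map_ofFn]
  simp [Function.comp_def]

/-- The operators by which the generators act at `t = 0`. -/
def bruhatGen [IsDomain k] :
    EGen n → Module.End (MvPolynomial (Fin n) k) (BruhatModule n k)
  | .br i j _ => bracketOpZero i j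
  | .x a => xiOp k a

theorem bruhatGen_rel [IsDomain k]
    ⦃a b : FreeAlgebra (MvPolynomial (Fin n) k) (EGen n)⦄ (h : ETildeRel n k 0 a b) :
    FreeAlgebra.lift (MvPolynomial (Fin n) k) (bruhatGen (n := n) (k := k)) a =
      FreeAlgebra.lift (MvPolynomial (Fin n) k) (bruhatGen (n := n) (k := k)) b := by
  refine Finsupp.lhom_ext fun w f => ?_
  cases h with
  | antisymm i j h =>
    simp only [map_neg, FreeAlgebra.lift_ι_apply, bruhatGen, LinearMap.neg_apply,
      bracketOpZero_single]
    rw [bruhatSign_antisymm h, Equiv.swap_comm j i, ← Finsupp.single_neg]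
    simp
  | sq i j h =>
    simp only [map_mul, map_zero, FreeAlgebra.lift_ι_apply, bruhatGen, Module.End.mul_apply,
      bracketOpZero_single, ← mul_assoc, ← Int.cast_mul]
    rw [mul_comm (bruhatSign _ _ _), bruhatSign_mul_self]
    simp
  | comm i j a b h h' hd =>
    have h1 : i ≠ a := by rintro rfl; simp at hd
    have h2 : i ≠ b := by rintro rfl; simp at hd
    have h3 : j ≠ a := by rintro rfl; simp at hd
    have h4 : j ≠ b := by rintro rfl; simp at hd
    simp only [map_mul, FreeAlgebra.lift_ι_apply, bruhatGen, Module.End.mul_apply,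
      bracketOpZero_single, ← mul_assoc, ← Int.cast_mul]
    have key := bruhatSign_comm h h' h1 h2 h3 h4 w
    rw [mul_comm (bruhatSign i j _), key, mul_comm (bruhatSign i j _)]
    congr 1
    ext c
    simp only [Equiv.Perm.mul_apply, Equiv.swap_apply_def]
    grind
  | three i j a h₁ h₂ h₃ =>
    simp only [map_add, map_mul, map_zero, FreeAlgebra.lift_ι_apply, bruhatGen,
      LinearMap.add_apply, Module.End.mul_apply, bracketOpZero_single, ← mul_assoc,
      ← Int.cast_mul]
    have e1 : w * Equiv.swap a i * Equiv.swap j a = w * Equiv.swap j a * Equiv.swap i j := by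
      ext c
      simp only [Equiv.Perm.mul_apply, Equiv.swap_apply_def]
      grind
    have e2 : w * Equiv.swap i j * Equiv.swap a i = w * Equiv.swap j a * Equiv.swap i j := by
      ext c
      simp only [Equiv.Perm.mul_apply, Equiv.swap_apply_def]
      grind
    have key := bruhatSign_three h₁ h₂ h₃.symm w
    have key' : bruhatSign i j (w * Equiv.swap j a) * bruhatSign j a w +
        bruhatSign j a (w * Equiv.swap a i) * bruhatSign a i w +
        bruhatSign a i (w * Equiv.swap i j) * bruhatSign i j w = 0 := by
      linear_combination key
    rw [e1, e2, ← Finsupp.single_add, ← Finsupp.single_add, ← add_mul, ← add_mul,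
      ← Int.cast_add, ← Int.cast_add, key']
    simp
  | x_comm a b =>
    simp only [map_mul, FreeAlgebra.lift_ι_apply, bruhatGen, Module.End.mul_apply, xiOp_single]
    rw [mul_left_comm]
  | br_x i j a h hi hj =>
    simp only [map_mul, FreeAlgebra.lift_ι_apply, bruhatGen, Module.End.mul_apply, xiOp_single,
      bracketOpZero_single, Equiv.Perm.mul_apply, Equiv.swap_apply_of_ne_of_ne hi hj]
    rw [mul_left_comm]
  | br_x_left i j h =>
    simp only [map_mul, map_zero, add_zero, FreeAlgebra.lift_ι_apply, bruhatGen,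
      Module.End.mul_apply, xiOp_single, bracketOpZero_single, Equiv.Perm.mul_apply,
      Equiv.swap_apply_right]
    rw [mul_left_comm]
  | br_x_right i j h =>
    simp only [map_mul, map_zero, sub_zero, FreeAlgebra.lift_ι_apply, bruhatGen,
      Module.End.mul_apply, xiOp_single, bracketOpZero_single, Equiv.Perm.mul_apply,
      Equiv.swap_apply_left]
    rw [mul_left_comm]
  | esymm r h₁ h₂ =>
    rw [map_ncEval]
    simp only [FreeAlgebra.lift_ι_apply, bruhatGen]
    rw [ncEval_xiOp, AlgHom.commutes, Module.algebraMap_end_apply, Finsupp.smul_single,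
      smul_eq_mul]
    congr 2
    rw [MvPolynomial.esymm, map_sum, MvPolynomial.esymm]
    simp only [map_prod, MvPolynomial.eval_X]
    have := MvPolynomial.rename_esymm (Fin n) k r w
    simpa [MvPolynomial.esymm, map_sum, map_prod] using this

/-- The extended Bruhat representation at `t = 0`, as a representation of the extended quadratic
algebra at `t = 0` on `k[y]⟨S_n⟩`: `[i,j]` acts by `σ̃_{ij}` at `t = 0` and `x_a` by `ξ_a`. -/
def bruhatRepZero (n : ℕ) (k : Type*) [CommRing k] [IsDomain k] :
    ETilde n k 0 →ₐ[MvPolynomial (Fin n) k]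
      Module.End (MvPolynomial (Fin n) k) (BruhatModule n k) :=
  RingQuot.liftAlgHom (MvPolynomial (Fin n) k)
    ⟨FreeAlgebra.lift (MvPolynomial (Fin n) k) bruhatGen, bruhatGen_rel⟩

theorem bruhatRepZero_mk [IsDomain k] (a : FreeAlgebra (MvPolynomial (Fin n) k) (EGen n)) :
    bruhatRepZero n k (ETilde.mk n 0 a) = FreeAlgebra.lift (MvPolynomial (Fin n) k) bruhatGen a :=
  RingQuot.liftAlgHom_mkAlgHom_apply _ _ bruhatGen_rel a

theorem bruhatRepZero_br [IsDomain k] (i j : Fin n) (h : i ≠ j) (v : BruhatModule n k) :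
    bruhatRepZero n k (ETilde.br 0 i j h) v = bracketOp 0 i j v := by
  rw [ETilde.br, bruhatRepZero_mk, FreeAlgebra.lift_ι_apply]
  rfl

theorem bruhatRepZero_x [IsDomain k] (a : Fin n) (v : BruhatModule n k) :
    bruhatRepZero n k (ETilde.x 0 a) v = xiOp k a v := by
  rw [ETilde.x, bruhatRepZero_mk, FreeAlgebra.lift_ι_apply]
  rfl
end
end

/-! The proof transports divided differences on polynomials to lowering operators on permutations.
Let `D_i` be the `k[y]`-linear operator `descentOp`, which sends `w` to `w s_i` at a descent and to
`0` otherwise. At `t = 0` the Dunkl operators satisfy the twisted commutation rule `D_i θ_a =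
θ_{s_i(a)} D_i + (δ_{a,i} - δ_{a,i+1})` (`descentOp_dunklOp`). The scalar is `∂_i x_a`, so by the
Leibniz rule `D_i p(θ) = (∂_i p)(θ) + (s_i p)(θ) D_i` for every polynomial `p` (`descentOp_apply`).
The identity permutation has no descents, so `D_i` kills it, and `(∂_i p)(θ) id = D_i (p(θ) id)`;
iterating along a word gives `apply_foldr_divDiff`.

It remains to know the top polynomial and the effect of the `D_i` on it. Applied to `id`, the
staircase product gives `w₀`: taken in the right order, each factor `θ_i - y_j` meets a permutation
with exactly one cover through position `i`, and moves to that cover (`apply_doubleSchubertTop`).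
Along a reduced word of `w⁻¹ w₀` every `D_i` then meets a descent, so `w₀` is carried to `w₀ (w⁻¹
w₀)⁻¹ = w` (`foldr_descentOp`).

The combinatorial core is `cover_adj_iff`, which says how Bruhat covers interact with right
multiplication by `s_i`. It makes `D_i` intertwine `[a,b]` with `[s_i(a),s_i(b)]`, except for the
pair `{i,i+1}`, which produces the scalar. -/

/-! ### Evaluation at commuting elements -/

/-- A commuting family generates a commutative subalgebra, in which ordered monomials are ordinary
ones and `MvPolynomial.aeval` is available. This makes `ncEval` multiplicative, which the induction
on polynomials and the factorisation of the top polynomial require. -/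
theorem exists_algHom_eq_ncEval {n : ℕ} {B S : Type*} [CommRing B] [Ring S] [Algebra B S]
    (v : Fin n → S) (hv : ∀ i j, Commute (v i) (v j)) :
    ∃ Φ : MvPolynomial (Fin n) B →ₐ[B] S,
      (∀ i, Φ (MvPolynomial.X i) = v i) ∧ ∀ p, ncEval v p = Φ p := by
  let _ : CommRing (Algebra.adjoin B (Set.range v)) :=
    { (inferInstance : Ring (Algebra.adjoin B (Set.range v))) with
      mul_comm := fun a b => (Algebra.isMulCommutative_adjoin B (by
        rintro _ ⟨i, rfl⟩ _ ⟨j, rfl⟩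
        exact hv i j)).is_comm.comm a b }
  let v' : Fin n → Algebra.adjoin B (Set.range v) :=
    fun i => ⟨v i, Algebra.subset_adjoin ⟨i, rfl⟩⟩
  refine ⟨(Algebra.adjoin B (Set.range v)).val.comp (MvPolynomial.aeval v'), fun i => ?_,
    fun p => ?_⟩
  · simp [v']
  · have h : MvPolynomial.aeval v' p = ncEval v' p := by
      rw [MvPolynomial.aeval_def, MvPolynomial.eval₂_eq', ncEval]
      refine Finset.sum_congr rfl fun m _ => ?_
      rw [List.prod_ofFn, Algebra.smul_def]
    rw [AlgHom.comp_apply, h, map_ncEval]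
    rfl

/-! ### Leibniz rule and values of divided differences -/

section DivDiff

variable {n : ℕ} {k : Type*} [CommRing k] [IsDomain k] {a b : Fin n}

/-- Exact quotients by the nonzero element `X a - X b` of a domain can be compared after multiplying
back; the same device gives the values on constants and variables. -/
theorem divDiff_mul (h : a ≠ b) (f g : MvPolynomial (Fin n) k) :
    divDiff k a b (f * g) =
      divDiff k a b f * g + MvPolynomial.rename (Equiv.swap a b) f * divDiff k a b g := by
  apply mul_left_cancel₀ (X_sub_X_ne_zero (k := k) h)
  have hf := X_sub_X_mul_divDiff (k := k) h f
  have hg := X_sub_X_mul_divDiff (k := k) h g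
  rw [X_sub_X_mul_divDiff h, map_mul]
  linear_combination (-g) * hf - MvPolynomial.rename (Equiv.swap a b) f * hg

theorem divDiff_C (h : a ≠ b) (c : k) :
    divDiff k a b (MvPolynomial.C c) = 0 := by
  apply mul_left_cancel₀ (X_sub_X_ne_zero (k := k) h)
  rw [X_sub_X_mul_divDiff h]
  simp

theorem divDiff_X (h : a ≠ b) (c : Fin n) :
    divDiff k a b (MvPolynomial.X c) =
      MvPolynomial.C ((if c = a then 1 else 0) - (if c = b then 1 else 0)) := by
  apply mul_left_cancel₀ (X_sub_X_ne_zero (k := k) h)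
  rw [X_sub_X_mul_divDiff h, MvPolynomial.rename_X, Equiv.swap_apply_def]
  by_cases h1 : c = a
  · subst h1; simp [h]
  · by_cases h2 : c = b
    · subst h2; simp [h1]
    · simp [h1, h2]

end DivDiff

/-! ### Bruhat covers and adjacent transpositions -/

section Length

variable {n : ℕ}

theorem invNum_inv (w : Equiv.Perm (Fin n)) : invNum w⁻¹ = invNum w := by
  unfold invNum
  refine Finset.card_bij' (fun p _ => (w⁻¹ p.2, w⁻¹ p.1)) (fun p _ => (w p.2, w p.1)) ?_ ?_ ?_ ?_
  all_goals simp +contextual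

theorem invNum_mul_adj (w : Equiv.Perm (Fin n)) (i : Fin (n - 1)) :
    invNum (w * Equiv.swap (adjLeft i) (adjRight i)) = invNum w + 1 ↔
      w (adjLeft i) < w (adjRight i) := by
  rw [invNum_mul_swap_eq_iff _ (adjLeft_lt_adjRight i), and_iff_left]
  intro c h1 h2
  simp only [adjLeft, adjRight, Fin.lt_def] at h1 h2
  omega

theorem adj_swap_lt {i : Fin (n - 1)} {a b : Fin n} (hab : a < b)
    (h : ¬ (a = adjLeft i ∧ b = adjRight i)) :
    Equiv.swap (adjLeft i) (adjRight i) a < Equiv.swap (adjLeft i) (adjRight i) b := by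
  simp only [Equiv.swap_apply_def, adjLeft, adjRight, Fin.ext_iff, Fin.lt_def] at *
  split_ifs <;> (try simp only) <;> omega

/-- Both sides describe a path between `w` and `w t_{ab} s_i = (w s_i) t_{s(a) s(b)}`, where `s =
s_i`. As `(a,b)` is not `(i,i+1)`, `s` keeps `a` and `b` in order, and the open interval from `a` to
`b` is matched by `s` with that from `s(a)` to `s(b)` up to the positions `i` and `i+1`. The descent
conditions settle those two. For instance, if `a = i` and `w(i) < w(i+1)`, a descent after the swap
puts `w(i+1)` strictly between `w(a)` and `w(b)`, so the swap was not a cover. -/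
theorem cover_adj_iff (w : Equiv.Perm (Fin n)) {i : Fin (n - 1)} {a b : Fin n} (hab : a < b)
    (h : ¬ (a = adjLeft i ∧ b = adjRight i)) :
    (invNum (w * Equiv.swap a b) = invNum w + 1 ∧
      (w * Equiv.swap a b) (adjRight i) < (w * Equiv.swap a b) (adjLeft i)) ↔
    (w (adjRight i) < w (adjLeft i) ∧
      invNum (w * Equiv.swap (adjLeft i) (adjRight i) *
        Equiv.swap (Equiv.swap (adjLeft i) (adjRight i) a)
          (Equiv.swap (adjLeft i) (adjRight i) b)) =
        invNum (w * Equiv.swap (adjLeft i) (adjRight i)) + 1) := by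
  rw [invNum_mul_swap_eq_iff _ hab, invNum_mul_swap_eq_iff _ (adj_swap_lt hab h)]
  have inj := w.injective
  have hlt := adjLeft_lt_adjRight i
  have hadj : ∀ c, adjLeft i < c → c < adjRight i → False := by
    intro c h1 h2
    simp only [adjLeft, adjRight, Fin.lt_def] at h1 h2
    omega
  -- From here on only `p < q` with nothing in between matters.
  generalize adjLeft i = p at *
  generalize adjRight i = q at *
  have hp : ∀ c, c < q → c ≠ p → c < p := fun c h1 h2 =>
    lt_of_le_of_ne (not_lt.1 fun h3 => hadj c h3 h1) h2
  have hq : ∀ c, p < c → c ≠ q → q < c := fun c h1 h2 =>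
    lt_of_le_of_ne (not_lt.1 fun h3 => hadj c h1 h3) h2.symm
  have hs : ∀ c, Equiv.swap p q c = if c = p then q else if c = q then p else c :=
    fun c => Equiv.swap_apply_def ..
  set s := Equiv.swap p q
  have hss : ∀ c, s (s c) = c := Equiv.swap_apply_self p q
  have hlt' : ∀ {c d}, ¬ (c = p ∧ d = q) → c < d → s c < s d := by
    intro c d
    grind
  have hlt2 : ∀ {c d}, ¬ (s c = p ∧ s d = q) → s c < s d → c < d := by
    intro c d h1 h2
    simpa [hss] using hlt' h1 h2
  have hsp : s p = q := Equiv.swap_apply_left p q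
  have hsq : s q = p := Equiv.swap_apply_right p q
  have hne : ∀ c d, w c = w d ↔ c = d := fun c d => inj.eq_iff
  simp only [Equiv.Perm.mul_apply, hss]
  -- Substituting `s c` for `c` makes both cover conditions speak of the same values `w c`.
  have hr : ((∀ c, s a < c → c < s b → w a < w (s c) → w (s c) < w b → False) ↔
      ∀ c, s a < s c → s c < s b → w a < w c → w c < w b → False) := by
    refine ⟨fun H c => ?_, fun H c => ?_⟩
    · simpa only [hss] using H (s c)
    · simpa only [hss] using H (s c)
  have hp1 : Equiv.swap a b p = if p = a then b else if p = b then a else p :=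
    Equiv.swap_apply_def ..
  have hq1 : Equiv.swap a b q = if q = a then b else if q = b then a else q :=
    Equiv.swap_apply_def ..
  rw [hr, hp1, hq1]
  clear hr hp1 hq1
  clear_value s
  constructor
  · rintro ⟨⟨h1, h2⟩, h3⟩
    -- The two intervals can differ only at `p` and `q`, so the cover condition is instantiated
    -- there.
    have := h2 p
    have := h2 q
    refine ⟨by grind, h1, fun c => ?_⟩
    have := h2 c
    have := @hlt2 a c
    have := @hlt2 c b
    intro h4 h5
    grind
  · rintro ⟨h1, h2, h3⟩
    have := h3 p
    have := h3 q
    refine ⟨⟨h2, fun c => ?_⟩, by grind⟩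
    have := h3 c
    have := @hlt' a c
    have := @hlt' c b
    intro h4 h5
    grind

theorem swap_ne_adj {i : Fin (n - 1)} {a b : Fin n}
    (h : b ≠ Equiv.swap (adjLeft i) (adjRight i) a) :
    ¬ (a = adjLeft i ∧ b = adjRight i) ∧ ¬ (b = adjLeft i ∧ a = adjRight i) := by
  constructor <;> (rintro ⟨rfl, rfl⟩; simp at h)

/-- The signed form of `cover_adj_iff`, valid for both orders of `a` and `b`: away from the adjacent
pair `s_i` preserves the order, hence also the sign. -/
theorem bruhatSign_adj (w : Equiv.Perm (Fin n)) {i : Fin (n - 1)} {a b : Fin n} (hab : a ≠ b)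
    (h : b ≠ Equiv.swap (adjLeft i) (adjRight i) a) :
    (if (w * Equiv.swap a b) (adjRight i) < (w * Equiv.swap a b) (adjLeft i) then
      bruhatSign a b w else 0) =
    if w (adjRight i) < w (adjLeft i) then
      bruhatSign (Equiv.swap (adjLeft i) (adjRight i) a) (Equiv.swap (adjLeft i) (adjRight i) b)
        (w * Equiv.swap (adjLeft i) (adjRight i)) else 0 := by
  obtain ⟨h1, h2⟩ := swap_ne_adj h
  rcases lt_or_gt_of_ne hab with h3 | h3
  · have hc := cover_adj_iff w h3 h1
    have h4 := adj_swap_lt h3 h1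
    simp only [bruhatSign, if_pos h3, if_pos h4]
    simp only [Equiv.Perm.mul_apply] at hc ⊢
    grind
  · have hc := cover_adj_iff w h3 h2
    have h4 := adj_swap_lt h3 h2
    simp only [bruhatSign, if_neg h3.not_gt, if_neg h4.not_gt, Equiv.swap_comm a b]
    simp only [Equiv.Perm.mul_apply] at hc ⊢
    grind

theorem bruhatSign_self (a : Fin n) (w : Equiv.Perm (Fin n)) : bruhatSign a a w = 0 := by
  simp only [bruhatSign, Equiv.swap_self]
  simp [← Equiv.Perm.one_def]

theorem bruhatSign_adjLeft_adjRight (i : Fin (n - 1)) (w : Equiv.Perm (Fin n)) :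
    bruhatSign (adjLeft i) (adjRight i) w = if w (adjLeft i) < w (adjRight i) then 1 else 0 := by
  simp [bruhatSign, adjLeft_lt_adjRight, invNum_mul_adj]

end Length

/-! ### Lowering operators and their commutation with the Dunkl operators -/

noncomputable section

variable {n : ℕ} {k : Type*} [CommRing k] 

/-- The `k[y]`-linear operator on `k[y]⟨S_n⟩` that maps `w` to `w s_i` if `l(w s_i) < l(w)` and to
`0` otherwise. -/
def descentOp (k : Type*) [CommRing k] (i : Fin (n - 1)) :
    BruhatModule n k →ₗ[MvPolynomial (Fin n) k] BruhatModule n k :=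
  Finsupp.lsum (MvPolynomial (Fin n) k) fun w =>
    if w (adjRight i) < w (adjLeft i) then
      Finsupp.lsingle (w * Equiv.swap (adjLeft i) (adjRight i)) else 0

theorem descentOp_single (i : Fin (n - 1)) (w : Equiv.Perm (Fin n)) (f : MvPolynomial (Fin n) k) :
    descentOp k i (Finsupp.single w f) =
      Finsupp.single (w * Equiv.swap (adjLeft i) (adjRight i))
        (if w (adjRight i) < w (adjLeft i) then f else 0) := by
  rw [descentOp, Finsupp.lsum_single]
  split_ifs <;> simp

/-- The operator by which the Dunkl element `θ_a` acts at `t = 0`. -/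
def dunklOp (k : Type*) [CommRing k] [IsDomain k] (a : Fin n) :
    Module.End (MvPolynomial (Fin n) k) (BruhatModule n k) :=
  xiOp k a + ∑ b, bracketOpZero a b

/-- Makes the diagonal term of `dunklOp` harmless; summing over all `b` allows reindexing by a
permutation. -/
theorem bracketOpZero_self [IsDomain k] (a : Fin n) :
    (bracketOpZero a a : BruhatModule n k →ₗ[MvPolynomial (Fin n) k] BruhatModule n k) = 0 := by
  refine Finsupp.lhom_ext fun w f => ?_
  simp [bracketOpZero_single, bruhatSign_self]

theorem bruhatRepZero_dunkl [IsDomain k] (a : Fin n) :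
    bruhatRepZero n k (ETilde.dunkl 0 a) = dunklOp k a := by
  have hbr : ∀ b (h : a ≠ b), bruhatRepZero n k (ETilde.br 0 a b h) = bracketOpZero a b :=
    fun b h => LinearMap.ext fun v => bruhatRepZero_br a b h v
  have hx : bruhatRepZero n k (ETilde.x 0 a) = xiOp k a :=
    LinearMap.ext fun v => bruhatRepZero_x a v
  rw [ETilde.dunkl, map_add, map_sum, hx, dunklOp]
  congr 1
  rw [Finset.sum_congr rfl fun (b : {b // a ≠ b}) _ => hbr b b.2,
    ← Finset.sum_subtype {b | a ≠ b} (by simp) fun b => bracketOpZero a b]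
  refine Finset.sum_subset (Finset.subset_univ _) fun b _ hb => ?_
  obtain rfl : a = b := by simpa using hb
  exact bracketOpZero_self a

theorem bracketOpZero_antisymm [IsDomain k] {a b : Fin n} (h : a ≠ b) (v : BruhatModule n k) :
    bracketOpZero b a v = -bracketOpZero a b v := by
  induction v using Finsupp.induction_linear with
  | zero => simp
  | add f g hf hg => simp only [map_add, hf, hg]; abel
  | single w f =>
    simp [bracketOpZero_single, bruhatSign_antisymm h, Equiv.swap_comm b a]

theorem descentOp_xiOp (i : Fin (n - 1)) (a : Fin n) (v : BruhatModule n k) :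
    descentOp k i (xiOp k a v) =
      xiOp k (Equiv.swap (adjLeft i) (adjRight i) a) (descentOp k i v) := by
  induction v using Finsupp.induction_linear with
  | zero => simp
  | add f g hf hg => simp only [map_add, hf, hg]
  | single w f =>
    simp only [xiOp_single, descentOp_single, Equiv.Perm.mul_apply, Equiv.swap_apply_self,
      mul_ite, mul_zero]

/-- The target permutations agree because `s_i t_{ab} s_i` is the transposition of `s_i(a)` and
`s_i(b)`; the coefficients agree by `bruhatSign_adj`. -/
theorem descentOp_bracketOpZero [IsDomain k] {i : Fin (n - 1)} {a b : Fin n}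
    (h : b ≠ Equiv.swap (adjLeft i) (adjRight i) a) (v : BruhatModule n k) :
    descentOp k i (bracketOpZero a b v) =
      bracketOpZero (Equiv.swap (adjLeft i) (adjRight i) a)
        (Equiv.swap (adjLeft i) (adjRight i) b) (descentOp k i v) := by
  rcases eq_or_ne a b with rfl | hab
  · simp [bracketOpZero_self]
  induction v using Finsupp.induction_linear with
  | zero => simp
  | add f g hf hg => simp only [map_add, hf, hg]
  | single w f =>
    have key := congrArg (Int.cast : ℤ → MvPolynomial (Fin n) k) (bruhatSign_adj w hab h)
    have hs : w * Equiv.swap (adjLeft i) (adjRight i) *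
        Equiv.swap (Equiv.swap (adjLeft i) (adjRight i) a) (Equiv.swap (adjLeft i) (adjRight i) b) =
        w * Equiv.swap a b * Equiv.swap (adjLeft i) (adjRight i) := by
      rw [Equiv.swap_apply_apply]
      simp [mul_assoc]
    simp only [bracketOpZero_single, descentOp_single, hs]
    congr 1
    simp only [Int.cast_ite, Int.cast_zero] at key
    rw [mul_ite, mul_zero, ← ite_zero_mul, ← ite_zero_mul, key]

/-- Source of the scalar in the commutation rule. At an ascent of `w` the bracket goes up to `w s_i`
and `D_i` brings it back; at a descent `D_i` goes down first and `[i+1,i]` returns `-w`, cancelling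
the extra `w`. -/
theorem descentOp_bracketOpZero_adj [IsDomain k] (i : Fin (n - 1)) (v : BruhatModule n k) :
    descentOp k i (bracketOpZero (adjLeft i) (adjRight i) v) =
      bracketOpZero (adjRight i) (adjLeft i) (descentOp k i v) + v := by
  induction v using Finsupp.induction_linear with
  | zero => simp
  | add f g hf hg => simp only [map_add, hf, hg]; abel
  | single w f =>
    have hne := (adjLeft_lt_adjRight i).ne
    have hw : w (adjLeft i) ≠ w (adjRight i) := fun h => hne (w.injective h)
    simp only [bracketOpZero_single, descentOp_single, bruhatSign_antisymm hne,
      bruhatSign_adjLeft_adjRight, Equiv.swap_comm (adjRight i) (adjLeft i), mul_assoc,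
      Equiv.swap_mul_self, mul_one, Equiv.Perm.mul_apply, Equiv.swap_apply_left,
      Equiv.swap_apply_right]
    rcases lt_or_gt_of_ne hw with h | h <;> simp [h, h.not_gt]

/-- In the sum over `b` only `b = s_i(a)` is exceptional: it gives `v` for `a = i`, `-v` for `a =
i+1`, and a zero diagonal bracket when `s_i` fixes `a`. -/
theorem descentOp_dunklOp [IsDomain k] (i : Fin (n - 1)) (a : Fin n) (v : BruhatModule n k) :
    descentOp k i (dunklOp k a v) =
      dunklOp k (Equiv.swap (adjLeft i) (adjRight i) a) (descentOp k i v) +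
        ((if a = adjLeft i then 1 else 0) - (if a = adjRight i then 1 else 0) :
          MvPolynomial (Fin n) k) • v := by
  set s := Equiv.swap (adjLeft i) (adjRight i) with hs
  have hne := (adjLeft_lt_adjRight i).ne
  have hb : ∀ b, descentOp k i (bracketOpZero a b v) =
      bracketOpZero (s a) (s b) (descentOp k i v) + if b = s a then
        ((if a = adjLeft i then 1 else 0) - (if a = adjRight i then 1 else 0) :
          MvPolynomial (Fin n) k) • v else 0 := by
    intro b
    split_ifs with h h1 h2 h2
    · exact absurd (h1.symm.trans h2) hne
    · subst h h1
      simpa [hs] using descentOp_bracketOpZero_adj i v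
    · have := descentOp_bracketOpZero_adj i v
      subst h h2
      rw [hs, Equiv.swap_apply_right, Equiv.swap_apply_left, bracketOpZero_antisymm hne, map_neg,
        this, bracketOpZero_antisymm hne]
      simp [add_comm]
    · subst h
      have : s a = a := Equiv.swap_apply_of_ne_of_ne h1 h2
      simp [this, bracketOpZero_self]
    · rw [add_zero]
      exact descentOp_bracketOpZero h v
  simp only [dunklOp, LinearMap.add_apply, LinearMap.sum_apply, map_add, map_sum, hb,
    descentOp_xiOp, Finset.sum_add_distrib, Finset.sum_ite_eq', Finset.mem_univ, if_true]
  rw [Equiv.sum_comp s fun b => bracketOpZero (s a) b (descentOp k i v), add_assoc]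

end

/-! ### Lowering the longest element along a reduced word -/

noncomputable section

variable {n : ℕ} {k : Type*} [CommRing k]

/-- Each letter changes the length by one, so equality of lengths for the whole word forces it for
the tail and makes the new letter an ascent of the tail's `v`. As `w₀` reverses order, this is a
descent of `w₀ v`, where the operator acts as right multiplication by `s_i`. -/
theorem foldr_descentOp (l : List (Fin (n - 1))) :
    let v := (l.map fun i => Equiv.swap (adjLeft i) (adjRight i)).prod⁻¹
    invNum v ≤ l.length ∧ (invNum v = l.length →
      l.foldr (fun i v => descentOp k i v) (Finsupp.single Fin.revPerm 1) =
        Finsupp.single (Fin.revPerm * v) 1) := by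
  induction l with
  | nil => simp +contextual [invNum, le_of_lt]
  | cons i l ih =>
    simp only [List.map_cons, List.prod_cons, mul_inv_rev, Equiv.swap_inv, List.length_cons,
      List.foldr_cons] at ih ⊢
    obtain ⟨h1, h2⟩ := ih
    generalize (l.map fun i => Equiv.swap (adjLeft i) (adjRight i)).prod⁻¹ = v at *
    have hasc := invNum_mul_adj v i
    by_cases hv : v (adjLeft i) < v (adjRight i)
    · rw [hasc.2 hv]
      refine ⟨by omega, fun h => ?_⟩
      rw [h2 (by omega), descentOp_single, if_pos (by simpa using hv), mul_assoc]
    -- At a descent of `v` the length drops, so the longer word cannot be reduced and the second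
    -- claim is vacuous.
    · have hdesc := invNum_mul_adj (v * Equiv.swap (adjLeft i) (adjRight i)) i
      have hne : v (adjLeft i) ≠ v (adjRight i) :=
        fun h => (adjLeft_lt_adjRight i).ne (v.injective h)
      rw [mul_assoc, Equiv.swap_mul_self, mul_one] at hdesc
      have := hdesc.2 (by simpa using lt_of_le_of_ne (not_lt.1 hv) hne.symm)
      exact ⟨by omega, fun h => by omega⟩

variable [IsDomain k]

/-! ### Divided differences as lowering operators -/

section DividedDifferences

variable (Φ : MvPolynomial (Fin n) (MvPolynomial (Fin n) k) →ₐ[MvPolynomial (Fin n) k]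
  Module.End (MvPolynomial (Fin n) k) (BruhatModule n k))

/-- The commutation rule for one Dunkl operator propagates to products exactly as the twisted
Leibniz rule `divDiff_mul` does. -/
theorem descentOp_apply (hΦ : ∀ a, Φ (MvPolynomial.X a) = dunklOp k a) (i : Fin (n - 1))
    (p : MvPolynomial (Fin n) (MvPolynomial (Fin n) k)) (v : BruhatModule n k) :
    descentOp k i (Φ p v) =
      Φ (divDiff (MvPolynomial (Fin n) k) (adjLeft i) (adjRight i) p) v +
        Φ (MvPolynomial.rename (Equiv.swap (adjLeft i) (adjRight i)) p) (descentOp k i v) := by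
  have hne := (adjLeft_lt_adjRight i).ne
  induction p using MvPolynomial.induction_on generalizing v with
  | C c =>
    rw [divDiff_C hne, MvPolynomial.rename_C, ← MvPolynomial.algebraMap_eq, AlgHom.commutes]
    simp [Module.algebraMap_end_apply]
  | add p q hp hq =>
    simp only [map_add, LinearMap.add_apply, hp, hq]
    abel
  | mul_X p a hp =>
    -- The last factor acts first, so the induction hypothesis is used at `θ_a v`; hence the
    -- generalization over `v`.
    rw [divDiff_mul hne, divDiff_X hne, map_mul, map_add, map_mul, map_mul, map_mul, map_mul,
      MvPolynomial.rename_X, hΦ, hΦ, ← MvPolynomial.algebraMap_eq, AlgHom.commutes]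
    simp only [LinearMap.add_apply, Module.End.mul_apply, hp, descentOp_dunklOp,
      Module.algebraMap_end_apply, map_add, map_smul]
    abel

theorem apply_foldr_divDiff (hΦ : ∀ a, Φ (MvPolynomial.X a) = dunklOp k a)
    (l : List (Fin (n - 1))) (p : MvPolynomial (Fin n) (MvPolynomial (Fin n) k)) :
    Φ (l.foldr (fun i g => divDiff (MvPolynomial (Fin n) k) (adjLeft i) (adjRight i) g) p)
        (Finsupp.single 1 1) =
      l.foldr (fun i v => descentOp k i v) (Φ p (Finsupp.single 1 1)) := by
  induction l with
  | nil => rfl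
  | cons i l ih =>
    rw [List.foldr_cons, List.foldr_cons, ← ih, descentOp_apply Φ hΦ, descentOp_single]
    -- The identity has no descent, which kills the twisted term.
    simp [(adjLeft_lt_adjRight i).not_gt]

end DividedDifferences

/-! ### The top polynomial sends the identity to the longest element -/

section Top

theorem dunklOp_single (a : Fin n) (w : Equiv.Perm (Fin n)) :
    dunklOp k a (Finsupp.single w 1) = Finsupp.single w (MvPolynomial.X (w a)) +
      ∑ b, Finsupp.single (w * Equiv.swap a b) (bruhatSign a b w : MvPolynomial (Fin n) k) := by
  simp [dunklOp, xiOp_single, bracketOpZero_single]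

/-- The permutation whose values are `n - 1, …, n - i, j` followed by the remaining elements in
increasing order. -/
def IsRevPrefix (i j : ℕ) (w : Equiv.Perm (Fin n)) : Prop :=
  ∀ a : Fin n, (w a : ℕ) = if (a : ℕ) < i then n - 1 - a else if (a : ℕ) = i then j else
    if (a : ℕ) ≤ i + j then a - i - 1 else a - i

/-- Positions before `i` carry values larger than `j`, so they give no cover with `i`. After `i` the
values increase, so the first one exceeding `j`, namely `j + 1` at position `i + j + 1`, blocks all
later ones. -/
theorem IsRevPrefix.bruhatSign {i j : ℕ} {w : Equiv.Perm (Fin n)} (hw : IsRevPrefix i j w)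
    (h : i + j + 2 ≤ n) (b : Fin n) :
    bruhatSign ⟨i, by omega⟩ b w = if b = ⟨i + j + 1, by omega⟩ then 1 else 0 := by
  have hi := hw ⟨i, by omega⟩
  have hb := hw b
  rcases lt_trichotomy b ⟨i, by omega⟩ with hlt | heq | hlt
  · have h1 : ¬ w b < w ⟨i, by omega⟩ := by
      rw [Fin.lt_def] at hlt ⊢
      simp only at hlt hi
      split_ifs at hi hb <;> omega
    have h2 : b ≠ ⟨i + j + 1, by omega⟩ := by
      intro h2
      simp only [Fin.lt_def, h2] at hlt
      omega
    simp [_root_.bruhatSign, hlt.not_gt, invNum_mul_swap_eq_iff _ hlt, h1, h2]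
  · rw [heq, bruhatSign_self, if_neg]
    simp only [Fin.ext_iff]
    omega
  · simp only [_root_.bruhatSign, if_pos hlt, invNum_mul_swap_eq_iff _ hlt]
    refine if_congr ?_ rfl rfl
    simp only [Fin.lt_def, Fin.ext_iff] at hlt ⊢
    simp only [if_neg (lt_irrefl i), if_true] at hi
    constructor
    · rintro ⟨h1, h2⟩
      -- Any other `b` with a larger value would have this position strictly between, contradicting
      -- the cover.
      have h3 := h2 ⟨i + j + 1, by omega⟩ (by simp only; omega)
      have h4 := hw ⟨i + j + 1, by omega⟩
      simp only at h3 h4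
      by_contra h5
      refine h3 ?_ ?_ ?_ <;> split_ifs at h4 hb <;> omega
    · intro h1
      refine ⟨?_, fun c h2 h3 => ?_⟩
      · split_ifs at hb <;> omega
      · have h4 := hw c
        split_ifs at h4 hb <;> omega

/-- Subtracting `y_j` removes the diagonal term, since `w(i) = j`, and a single cover remains. -/
theorem IsRevPrefix.dunklOp_sub {i j : ℕ} {w : Equiv.Perm (Fin n)} (hw : IsRevPrefix i j w)
    (h : i + j + 2 ≤ n) :
    dunklOp k ⟨i, by omega⟩ (Finsupp.single w 1) -
      (MvPolynomial.X ⟨j, by omega⟩ : MvPolynomial (Fin n) k) • Finsupp.single w 1 =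
      Finsupp.single (w * Equiv.swap ⟨i, by omega⟩ ⟨i + j + 1, by omega⟩) 1 := by
  have hj : w ⟨i, by omega⟩ = ⟨j, by omega⟩ := Fin.ext (by simpa using hw ⟨i, by omega⟩)
  rw [dunklOp_single, hj, Finset.sum_eq_single ⟨i + j + 1, by omega⟩]
  · simp [hw.bruhatSign h]
  · intro b _ hb
    simp [hw.bruhatSign h, hb]
  · simp

theorem IsRevPrefix.mul_swap {i j : ℕ} {w : Equiv.Perm (Fin n)} (hw : IsRevPrefix i j w)
    (h : i + j + 2 ≤ n) :
    IsRevPrefix i (j + 1) (w * Equiv.swap ⟨i, by omega⟩ ⟨i + j + 1, by omega⟩) := by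
  intro a
  rw [Equiv.Perm.mul_apply, hw, Equiv.swap_apply_def]
  simp only [Fin.ext_iff]
  by_cases h1 : (a : ℕ) = i
  · simp only [h1, if_true]
    split_ifs <;> omega
  · by_cases h2 : (a : ℕ) = i + j + 1
    · simp only [h2, if_true]
      split_ifs <;> (try simp only [not_true_eq_false] at *) <;> omega
    · simp only [h1, h2, if_false]
      split_ifs <;> omega

/-- Once position `i` holds the largest value still available, it joins the reversed prefix, and the
next position holds `0`. -/
theorem IsRevPrefix.succ {i : ℕ} {w : Equiv.Perm (Fin n)} (hw : IsRevPrefix i (n - 1 - i) w) :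
    IsRevPrefix (i + 1) 0 w := by
  intro a
  rw [hw a]
  have := a.2
  split_ifs <;> omega

theorem isRevPrefix_one : IsRevPrefix 0 0 (1 : Equiv.Perm (Fin n)) := by
  intro a
  simp only [Equiv.Perm.one_apply]
  split_ifs <;> omega

theorem IsRevPrefix.eq_revPerm {w : Equiv.Perm (Fin n)} (hw : IsRevPrefix n 0 w) :
    w = Fin.revPerm := by
  ext a
  rw [hw a, if_pos a.2, Fin.revPerm_apply, Fin.val_rev]
  omega

/-- The factor `x_i - y_j` of the top double Schubert polynomial, and `1` outside the staircase. -/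
def staircaseFactor (n i j : ℕ) : MvPolynomial (Fin n) (MvPolynomial (Fin n) ℤ) :=
  if h : i + j + 2 ≤ n then
    MvPolynomial.X ⟨i, by omega⟩ - MvPolynomial.C (MvPolynomial.X ⟨j, by omega⟩)
  else 1

theorem doubleSchubertTop_eq (n : ℕ) :
    doubleSchubertTop n =
      ∏ i ∈ Finset.range n, ∏ j ∈ Finset.range n, staircaseFactor n i j := by
  rw [doubleSchubertTop, Finset.prod_filter, Fintype.prod_prod_type, Finset.prod_range]
  refine Finset.prod_congr rfl fun i _ => ?_
  rw [Finset.prod_range]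
  refine Finset.prod_congr rfl fun j _ => ?_
  rw [staircaseFactor]
  split_ifs <;> first | rfl | (simp only at *; omega)

variable (Φ : MvPolynomial (Fin n) (MvPolynomial (Fin n) ℤ) →ₐ[MvPolynomial (Fin n) ℤ]
  Module.End (MvPolynomial (Fin n) ℤ) (BruhatModule n ℤ))

/-- Row `i` of the staircase raises the value at position `i` one step at a time. The minimum
records that factors outside the staircase equal `1`, so the value stops at `n - 1 - i`. -/
theorem IsRevPrefix.apply_prod (hΦ : ∀ a, Φ (MvPolynomial.X a) = dunklOp ℤ a) {i : ℕ}
    {w : Equiv.Perm (Fin n)} (hw : IsRevPrefix i 0 w) (m : ℕ) :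
    ∃ w', IsRevPrefix i (min m (n - 1 - i)) w' ∧
      Φ (∏ j ∈ Finset.range m, staircaseFactor n i j) (Finsupp.single w 1) =
        Finsupp.single w' 1 := by
  induction m with
  | zero => exact ⟨w, by simpa using hw, by simp⟩
  | succ m ih =>
    obtain ⟨w', h1, h2⟩ := ih
    -- The factors commute, so the new one can be made to act last; this order is what makes each
    -- factor meet the right permutation.
    rw [Finset.prod_range_succ, mul_comm, map_mul, Module.End.mul_apply, h2, staircaseFactor]
    split_ifs with h
    · rw [min_eq_left (by omega)] at h1
      rw [min_eq_left (by omega)]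
      refine ⟨_, h1.mul_swap h, ?_⟩
      rw [← h1.dunklOp_sub h, map_sub, hΦ, ← MvPolynomial.algebraMap_eq, AlgHom.commutes,
        LinearMap.sub_apply, Module.algebraMap_end_apply]
    · rw [min_eq_right (by omega)] at h1
      rw [min_eq_right (by omega)]
      exact ⟨w', h1, by simp⟩

theorem apply_doubleSchubertTop (hΦ : ∀ a, Φ (MvPolynomial.X a) = dunklOp ℤ a) :
    Φ (doubleSchubertTop n) (Finsupp.single 1 1) = Finsupp.single Fin.revPerm 1 := by
  have H : ∀ m, ∃ w : Equiv.Perm (Fin n), IsRevPrefix m 0 w ∧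
      Φ (∏ i ∈ Finset.range m, ∏ j ∈ Finset.range n, staircaseFactor n i j)
        (Finsupp.single 1 1) = Finsupp.single w 1 := by
    intro m
    induction m with
    | zero => exact ⟨1, isRevPrefix_one, by simp⟩
    | succ m ih =>
      obtain ⟨w, h1, h2⟩ := ih
      obtain ⟨w', h3, h4⟩ := h1.apply_prod Φ hΦ n
      rw [min_eq_right (by omega)] at h3
      refine ⟨w', h3.succ, ?_⟩
      rw [Finset.prod_range_succ, mul_comm, map_mul, Module.End.mul_apply, h2, h4]
  obtain ⟨w, h1, h2⟩ := H n
  rw [doubleSchubertTop_eq, h2, h1.eq_revPerm]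

end Top

end

/-! ### The main theorem -/

theorem theorem3p2 (n : ℕ) (w : Equiv.Perm (Fin n)) :
    bruhatRepZero n ℤ (ncEval (ETilde.dunkl 0) (doubleSchubert w)) (Finsupp.single 1 1) =
      Finsupp.single w 1 := by
  obtain ⟨Φ, hX, hΦ⟩ := exists_algHom_eq_ncEval (B := MvPolynomial (Fin n) ℤ)
    (fun a => bruhatRepZero n ℤ (ETilde.dunkl 0 a))
    fun a b => (ETilde.dunkl_commute a b).map (bruhatRepZero n ℤ)
  replace hX : ∀ a, Φ (MvPolynomial.X a) = dunklOp ℤ a :=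
    fun a => (hX a).trans (bruhatRepZero_dunkl a)
  -- This is the choice made by `reducedWord`, so it is reducedness of the word occurring in
  -- `divDiffPerm`.
  obtain ⟨hprod, hlen⟩ := (exists_isReducedWord (w⁻¹ * Fin.revPerm)).choose_spec
  have h := (foldr_descentOp (k := ℤ) (reducedWord (w⁻¹ * Fin.revPerm))).2
  rw [map_ncEval, hΦ, doubleSchubert, divDiffPerm, apply_foldr_divDiff Φ hX,
    apply_doubleSchubertTop Φ hX]
  change (List.map _ (reducedWord (w⁻¹ * Fin.revPerm))).prod = _ at hprod
  change (reducedWord (w⁻¹ * Fin.revPerm)).length = _ at hlen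
  -- The word multiplies to the inverse of the permutation whose length `foldr_descentOp` measures.
  rw [hprod, invNum_inv] at h
  rw [h hlen.symm]
  simp
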